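/- Let $0<a<b$ and $c_l>0$. Let $W^{1,2}_l(0,1)=\{K\in W^{1,2}(0,1): K(0)=0\}$ and, for measurable $B:(0,1)\to[a,b]$, let $$\mathcal W_B(K)=\tfrac12\int_0^1 B(t)\,K'(t)^2\,dt+\int_0^1(1-t)\sin K(t)\,dt,\qquad K\in W^{1,2}_l(0,1).$$ For $\theta\in L^\infty((0,1);[0,1])$ put $B_\theta=(1-\theta)a+\theta b$. **Theorem (existence of optimal designs).** For every $\theta\in L^\infty((0,1);[0,1])$ the functional $\mathcal W_{B_\theta}$ has a unique global minimiser $K[B_\theta]$ in $W^{1,2}_l(0,1)$, and the functional $$\hat{\mathcal J}:L^\infty((0,1);[0,1])\to\mathbb R,\qquad \hat{\mathcal J}[\theta]=-\int_0^1(1-t)\sin K[B_\theta](t)\,dt+c_l\int_0^1\theta(t)\,dt,$$ which is therefore well defined, attains its minimum: there is $\theta_0\in L^\infty((0,1);[0,1])$ with $\hat{\mathcal J}[\theta_0]\le\hat{\mathcal J}[\theta]$ for all $\theta\in L^\infty((0,1);[0,1])$. -/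

import Mathlib

namespace PlateDesign

open MeasureTheory

/-- Lebesgue measure on the interval `(0, 1)`. -/
noncomputable abbrev unitMeasure : Measure ℝ := volume.restrict (Set.Ioo (0 : ℝ) 1)

/-- The Sobolev space `W^{1,2}_l(0, 1)` of functions in `W^{1,2}(0, 1)` vanishing at `0`.
An element is given by its continuous representative on `[0, 1]`: an absolutely continuous
function whose (almost everywhere defined) derivative, which is its weak derivative, belongs to
`L²(0, 1)`. The values outside `[0, 1]` are irrelevant. -/
def W12l : Set (ℝ → ℝ) :=
  {K | AbsolutelyContinuousOnInterval K 0 1 ∧ MemLp (deriv K) 2 unitMeasure ∧ K 0 = 0}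

/-- The energy of the phase `K` for the hardness `B` under the downward unit force `-e₃`:
here `F(t) = ∫ s in t..1, -e₃ = -(1 - t) e₃` and `u' = (cos K, 0, sin K)`, so that
`½ ∫ B (K')² - ∫ F ⬝ u' = ½ ∫ B (K')² + ∫ (1 - t) sin K`. -/
noncomputable def phaseEnergy (B K : ℝ → ℝ) : ℝ :=
  (1 / 2) * (∫ t in (0 : ℝ)..1, B t * (deriv K t) ^ 2)
    + ∫ t in (0 : ℝ)..1, (1 - t) * Real.sin (K t)

/-- `K` is a global minimiser of the energy `phaseEnergy B` within `W^{1,2}_l(0, 1)`. -/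
def IsPhaseMinimiser (B K : ℝ → ℝ) : Prop :=
  K ∈ W12l ∧ ∀ L ∈ W12l, phaseEnergy B K ≤ phaseEnergy B L

/-- The phase `K[B]`: the global minimiser of the energy `phaseEnergy B`. -/
noncomputable def phase (B : ℝ → ℝ) : ℝ → ℝ :=
  Classical.epsilon (IsPhaseMinimiser B)

/-- The set `L^∞((0, 1); [0, 1])` of designs, as a subset of `L^∞(0, 1)`. -/
def designs : Set (Lp ℝ ⊤ unitMeasure) :=
  {θ | ∀ᵐ t ∂unitMeasure, θ t ∈ Set.Icc (0 : ℝ) 1}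

/-- The hardness `B_θ = (1 - θ) a + θ b`. -/
noncomputable def hardness (a b : ℝ) (θ : Lp ℝ ⊤ unitMeasure) : ℝ → ℝ :=
  fun t => (1 - θ t) * a + θ t * b

/-- The cost `J[K, θ] = - ∫ (1 - t) sin K + c_l ∫ θ`. -/
noncomputable def cost (c : ℝ) (K : ℝ → ℝ) (θ : Lp ℝ ⊤ unitMeasure) : ℝ :=
  -(∫ t in (0 : ℝ)..1, (1 - t) * Real.sin (K t)) + c * ∫ t in (0 : ℝ)..1, θ t

/-- The relaxed cost functional `Ĵ[θ] = J[K[B_θ], θ]`. -/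
noncomputable def relaxedCost (a b c : ℝ) (θ : Lp ℝ ⊤ unitMeasure) : ℝ :=
  cost c (phase (hardness a b θ)) θ

end PlateDesign

namespace PlateDesign

open MeasureTheory Filter Set
open scoped Topology

/-! The unknown is the derivative `g = K'` in `L²(0,1)`, with `K = prim g`; weak convergence of `g`
gives pointwise convergence of `K`.

For fixed `B` the energy is not convex, but `fold` maps `ℝ` onto `[-π/2, 0]`, is 1-Lipschitz and
never raises `sin`. Folding a competitor therefore does not raise its energy, and minimisers already
take values in `[-π/2, 0]` (`IsEnergyMin.prim_mem_Icc`). There `sin` is convex, so the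
Euler-Lagrange equation `B K' = -moment` both characterises minimisers and yields a strong convexity
gap (`IsHardness.energy_add_integral_le`), hence uniqueness. Existence is the direct method.

For the design problem, the right variable is the compliance `1 / B`, because `K' = -(1 / B) *
moment`. Along a minimising sequence of designs the compliances and the `K'` have weak limits; the
moments converge pointwise and boundedly, so the product passes to the limit and the limit phase
minimises the energy of the limit compliance (`IsHardness.isEnergyMin_of_weak`). The load term of
the cost converges. The volume term is increasing and affine in `B`, and `B` is a convex function of
the compliance, so it is lower semicontinuous (`IsHardness.integral_le_of_weak`). The optimal design
is read off from the limit compliance; it need not be the weak limit of the designs. -/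

theorem intervalIntegral_eq_integral_unit (f : ℝ → ℝ) :
    ∫ t in (0 : ℝ)..1, f t = ∫ t, f t ∂unitMeasure := by
  rw [intervalIntegral.integral_of_le zero_le_one, integral_Ioc_eq_integral_Ioo]

instance : IsProbabilityMeasure unitMeasure := ⟨by simp [unitMeasure]⟩

theorem ae_unit_mem : ∀ᵐ t ∂unitMeasure, t ∈ Ioo (0 : ℝ) 1 :=
  ae_restrict_mem measurableSet_Ioo

/-! ### Weak convergence in `L²`. -/

/-- Sequential weak compactness of bounded sets in `L²`. -/
theorem exists_weak_limit {α : Type*} [MeasurableSpace α]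
    [MeasurableSpace.CountablyGenerated α] {μ : Measure α} [SFinite μ] {f : ℕ → α → ℝ} {C : ℝ}
    (hf : ∀ n, MemLp (f n) 2 μ) (hC : ∀ n, ∫ x, f n x ^ 2 ∂μ ≤ C) :
    ∃ g : α → ℝ, MemLp g 2 μ ∧ ∃ φ : ℕ → ℕ, StrictMono φ ∧ ∀ h : α → ℝ, MemLp h 2 μ →
      Tendsto (fun n => ∫ x, f (φ n) x * h x ∂μ) atTop (𝓝 (∫ x, g x * h x ∂μ)) := by
  have hpair : ∀ (u v : α → ℝ) (hu : MemLp u 2 μ) (hv : MemLp v 2 μ),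
      inner ℝ (hu.toLp u) (hv.toLp v) = ∫ x, u x * v x ∂μ := by
    intro u v hu hv
    rw [L2.inner_def]
    refine integral_congr_ae ?_
    filter_upwards [hu.coeFn_toLp, hv.coeFn_toLp] with x h1 h2
    rw [h1, h2]
    simp [mul_comm]
  have hnorm : ∀ n, ‖(hf n).toLp (f n)‖ ≤ √C := by
    intro n
    refine Real.le_sqrt_of_sq_le ?_
    rw [← real_inner_self_eq_norm_sq, hpair]
    simpa [sq] using hC n
  let F : ℕ → WeakDual ℝ (Lp ℝ 2 μ) := fun n =>
    StrongDual.toWeakDual (InnerProductSpace.toDual ℝ (Lp ℝ 2 μ) ((hf n).toLp (f n)))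
  have hF : ∀ n, F n ∈ WeakDual.toStrongDual ⁻¹'
      Metric.closedBall (0 : StrongDual ℝ (Lp ℝ 2 μ)) (√C) := by
    intro n
    have : ‖InnerProductSpace.toDual ℝ (Lp ℝ 2 μ) ((hf n).toLp (f n))‖ ≤ √C := by
      rw [LinearIsometryEquiv.norm_map]; exact hnorm n
    simpa [F] using this
  have : Fact ((2 : ENNReal) ≠ ⊤) := ⟨by simp⟩
  obtain ⟨ψ, -, φ, hφ, hlim⟩ := WeakDual.isSeqCompact_closedBall ℝ (Lp ℝ 2 μ) 0 (√C) hF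
  let g : Lp ℝ 2 μ := (InnerProductSpace.toDual ℝ (Lp ℝ 2 μ)).symm (WeakDual.toStrongDual ψ)
  refine ⟨g, Lp.memLp g, φ, hφ, fun h hh => ?_⟩
  have h1 := ((WeakDual.eval_continuous (𝕜 := ℝ) (hh.toLp h)).tendsto ψ).comp hlim
  have h2 : ψ (hh.toLp h) = ∫ x, g x * h x ∂μ := by
    have : inner ℝ g (hh.toLp h) = ψ (hh.toLp h) := InnerProductSpace.toDual_symm_apply
    rw [← this, ← hpair g h (Lp.memLp g) hh, Lp.toLp_coeFn]
  rw [← h2]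
  refine h1.congr fun n => ?_
  rw [← hpair _ _ (hf _) hh]
  rfl

theorem ae_eq_zero_of_forall_integral_mul_eq_zero {α : Type*} [MeasurableSpace α]
    {μ : Measure α} {f : α → ℝ} (hf : MemLp f 2 μ)
    (h : ∀ u : α → ℝ, MemLp u 2 μ → ∫ x, f x * u x ∂μ = 0) : f =ᵐ[μ] 0 := by
  have h1 := h f hf
  have h2 : (fun x => f x * f x) =ᵐ[μ] 0 :=
    (integral_eq_zero_iff_of_nonneg (fun x => mul_self_nonneg _) (hf.integrable_mul hf)).1 h1
  filter_upwards [h2] with x hx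
  simpa using hx

/-! ### Primitives of `L²` functions and load integrals. -/

/-- The primitive of `g` vanishing at `0`. -/
noncomputable def prim (g : ℝ → ℝ) (t : ℝ) : ℝ := ∫ s in (0 : ℝ)..t, g s

/-- The indicator function of `(-∞, t]`. -/
noncomputable def step (t : ℝ) : ℝ → ℝ := (Iic t).indicator 1

theorem memLp_step (t : ℝ) : MemLp (step t) 2 unitMeasure :=
  (memLp_const (1 : ℝ)).indicator measurableSet_Iic

/-- Evaluation of the primitive at a point is a pairing with an `L²` function, hence continuous for
weak convergence. -/
theorem prim_eq_integral_step (g : ℝ → ℝ) {t : ℝ} (ht : t ∈ Icc (0 : ℝ) 1) :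
    prim g t = ∫ s, g s * step t s ∂unitMeasure := by
  have h1 : (fun s => g s * step t s) = (Iic t).indicator g := by
    ext s
    by_cases hs : s ∈ Iic t <;> simp [step, hs]
  rw [prim, intervalIntegral.integral_of_le ht.1, h1, integral_indicator measurableSet_Iic,
    unitMeasure, ← restrict_Ioo_eq_restrict_Ioc.symm,
    Measure.restrict_restrict measurableSet_Iic, inter_comm, Ioc_inter_Iic, min_eq_right ht.2]

theorem intervalIntegrable_of_memLp {g : ℝ → ℝ} (hg : MemLp g 2 unitMeasure) :
    IntervalIntegrable g volume 0 1 := by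
  rw [intervalIntegrable_iff_integrableOn_Ioo_of_le zero_le_one]
  exact hg.integrable (by norm_num)

theorem absolutelyContinuousOnInterval_prim {g : ℝ → ℝ} (hg : MemLp g 2 unitMeasure) :
    AbsolutelyContinuousOnInterval (prim g) 0 1 :=
  (intervalIntegrable_of_memLp hg).absolutelyContinuousOnInterval_intervalIntegral (by simp)

theorem continuousOn_prim {g : ℝ → ℝ} (hg : MemLp g 2 unitMeasure) :
    ContinuousOn (prim g) (Icc 0 1) := by
  simpa using (absolutelyContinuousOnInterval_prim hg).continuousOn

theorem deriv_prim_ae {g : ℝ → ℝ} (hg : MemLp g 2 unitMeasure) :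
    deriv (prim g) =ᵐ[unitMeasure] g := by
  filter_upwards [ae_restrict_of_ae (intervalIntegrable_of_memLp hg).ae_hasDerivAt_integral,
    ae_unit_mem] with t ht hmem
  exact (ht (by simpa using ⟨hmem.1.le, hmem.2.le⟩) 0 (by simp)).deriv

theorem prim_mem_W12l {g : ℝ → ℝ} (hg : MemLp g 2 unitMeasure) : prim g ∈ W12l :=
  ⟨absolutelyContinuousOnInterval_prim hg, (memLp_congr_ae (deriv_prim_ae hg)).2 hg,
    by simp [prim]⟩

theorem prim_deriv_eqOn {K : ℝ → ℝ} (hK : K ∈ W12l) : EqOn (prim (deriv K)) K (Icc 0 1) := by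
  intro t ht
  have h : AbsolutelyContinuousOnInterval K 0 t :=
    hK.1.mono (by rw [uIcc_of_le ht.1, uIcc_of_le zero_le_one]; exact Icc_subset_Icc_right ht.2)
  rw [prim, h.integral_deriv_eq_sub, hK.2.2, sub_zero]

theorem prim_congr_ae {g h : ℝ → ℝ} (hgh : g =ᵐ[unitMeasure] h) :
    EqOn (prim g) (prim h) (Icc 0 1) := by
  intro t ht
  rw [prim_eq_integral_step g ht, prim_eq_integral_step h ht]
  refine integral_congr_ae ?_
  filter_upwards [hgh] with s hs
  rw [hs]

theorem prim_add_const_mul {g h : ℝ → ℝ} (hg : MemLp g 2 unitMeasure)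
    (hh : MemLp h 2 unitMeasure) (ε : ℝ) {t : ℝ} (ht : t ∈ Icc (0 : ℝ) 1) :
    prim (fun s => g s + ε * h s) t = prim g t + ε * prim h t := by
  have hsub : uIcc 0 t ⊆ uIcc (0 : ℝ) 1 := by
    rw [uIcc_of_le ht.1, uIcc_of_le zero_le_one]; exact Icc_subset_Icc_right ht.2
  have h1 := (intervalIntegrable_of_memLp hg).mono_set hsub
  have h2 := (intervalIntegrable_of_memLp hh).mono_set hsub
  simp only [prim]
  rw [intervalIntegral.integral_add h1 (h2.const_mul ε), intervalIntegral.integral_const_mul]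

theorem aestronglyMeasurable_of_continuousOn {f : ℝ → ℝ} (hf : ContinuousOn f (Icc 0 1)) :
    AEStronglyMeasurable f unitMeasure :=
  (hf.mono Ioo_subset_Icc_self).aestronglyMeasurable measurableSet_Ioo

/-- A load integral `∫ (1 - t) f (K t)` has an integrable integrand when `K` is continuous. -/
theorem integrable_load {K : ℝ → ℝ} (hK : ContinuousOn K (Icc 0 1)) {f : ℝ → ℝ}
    (hf : Continuous f) : Integrable (fun t => (1 - t) * f (K t)) unitMeasure := by
  have hc : ContinuousOn (fun t => (1 - t) * f (K t)) (Icc 0 1) :=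
    (by fun_prop : ContinuousOn (fun t : ℝ => 1 - t) (Icc 0 1)).mul (hf.comp_continuousOn hK)
  exact (hc.integrableOn_Icc).mono_set Ioo_subset_Icc_self

theorem tendsto_integral_load {K : ℕ → ℝ → ℝ} {K₀ : ℝ → ℝ} {f : ℝ → ℝ}
    (hf : Continuous f) (hb : ∀ x, |f x| ≤ 1) (hK : ∀ n, ContinuousOn (K n) (Icc 0 1))
    (hlim : ∀ t ∈ Icc (0 : ℝ) 1, Tendsto (fun n => K n t) atTop (𝓝 (K₀ t))) :
    Tendsto (fun n => ∫ t, (1 - t) * f (K n t) ∂unitMeasure) atTop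
      (𝓝 (∫ t, (1 - t) * f (K₀ t) ∂unitMeasure)) := by
  refine tendsto_integral_of_dominated_convergence (fun _ => 1)
    (fun n => (integrable_load (hK n) hf).aestronglyMeasurable) (integrable_const 1) ?_ ?_
  · intro n
    filter_upwards [ae_unit_mem] with t ht
    rw [Real.norm_eq_abs, abs_mul, abs_of_pos (by linarith [ht.2])]
    nlinarith [hb (K n t), abs_nonneg (f (K n t)), ht.1, ht.2]
  · filter_upwards [ae_unit_mem] with t ht
    exact ((hf.tendsto _).comp (hlim t (Ioo_subset_Icc_self ht))).const_mul _

/-! ### Folding phases into `[-π/2, 0]`. -/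

theorem _root_.LipschitzWith.comp_absolutelyContinuousOnInterval {C : NNReal} {T f : ℝ → ℝ}
    {x y : ℝ} (hT : LipschitzWith C T) (hf : AbsolutelyContinuousOnInterval f x y) :
    AbsolutelyContinuousOnInterval (fun t => T (f t)) x y := by
  apply squeeze_zero (fun t => ?_) (fun t => ?_)
    (by simpa using Tendsto.const_mul (C : ℝ) hf)
  · exact Finset.sum_nonneg fun i _ => dist_nonneg
  · rw [Finset.mul_sum]
    exact Finset.sum_le_sum fun i _ => hT.dist_le_mul _ _

/-- The folding map of `ℝ` onto `[-π/2, 0]`. -/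
noncomputable def fold (x : ℝ) : ℝ := max (-|x|) (-(Real.pi / 2))

theorem fold_mem (x : ℝ) : fold x ∈ Icc (-(Real.pi / 2)) 0 :=
  ⟨le_max_right _ _, max_le (by simp) (by linarith [Real.pi_pos])⟩

theorem lipschitzWith_fold : LipschitzWith 1 fold := by
  have h : LipschitzWith 1 fun x : ℝ => -|x| := by
    refine LipschitzWith.of_dist_le_mul fun x y => ?_
    simp only [Real.dist_eq, NNReal.coe_one, one_mul]
    rw [show -|x| - -|y| = |y| - |x| by ring, abs_sub_comm x y]
    exact abs_abs_sub_abs_le_abs_sub y x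
  exact h.max_const _

/-- For `|x| ≤ π/2` the folded sine is `-|sin x|`; beyond, it is the global minimum `-1`. -/
theorem sin_fold_le (x : ℝ) : Real.sin (fold x) ≤ Real.sin x := by
  rcases le_total |x| (Real.pi / 2) with h | h
  · rw [fold, max_eq_left (by linarith), Real.sin_neg]
    have h0 : 0 ≤ Real.sin |x| :=
      Real.sin_nonneg_of_nonneg_of_le_pi (abs_nonneg x) (by linarith [Real.pi_pos])
    rcases abs_choice x with hx | hx <;> rw [hx] at h0 ⊢
    · linarith
    · rw [Real.sin_neg]; linarith
  · rw [fold, max_eq_right (by linarith), Real.sin_neg, Real.sin_pi_div_two]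
    exact Real.neg_one_le_sin x

/-- The folding map strictly lowers `sin` on `(0, π/2]`. -/
theorem nonpos_of_sin_fold_eq {x : ℝ} (h : Real.sin (fold x) = Real.sin x)
    (hx : |x| ≤ Real.pi / 2) : x ≤ 0 := by
  by_contra! hpos
  rw [fold, max_eq_left (by linarith), abs_of_pos hpos, Real.sin_neg] at h
  have := Real.sin_pos_of_pos_of_lt_pi hpos
    (by linarith [le_abs_self x, Real.pi_pos])
  linarith

/-- Comparing difference quotients avoids a chain rule for the nonsmooth `T`; where the composite is
not differentiable, `deriv` is `0` by default. -/
theorem abs_deriv_comp_le {T f : ℝ → ℝ} (hT : LipschitzWith 1 T) {t : ℝ}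
    (hf : DifferentiableAt ℝ f t) : |deriv (fun s => T (f s)) t| ≤ |deriv f t| := by
  by_cases hd : DifferentiableAt ℝ (fun s => T (f s)) t
  · have h1 := (hasDerivAt_iff_tendsto_slope.1 hf.hasDerivAt).abs
    have h2 := (hasDerivAt_iff_tendsto_slope.1 hd.hasDerivAt).abs
    refine le_of_tendsto_of_tendsto' h2 h1 fun s => ?_
    rw [slope_def_field, slope_def_field, abs_div, abs_div]
    refine div_le_div_of_nonneg_right ?_ (abs_nonneg _)
    simpa [Real.dist_eq] using hT.dist_le_mul (f s) (f t)
  · rw [deriv_zero_of_not_differentiableAt hd]; simp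

theorem exists_fold {g : ℝ → ℝ} (hg : MemLp g 2 unitMeasure) :
    ∃ h : ℝ → ℝ, MemLp h 2 unitMeasure ∧ (∀ᵐ t ∂unitMeasure, |h t| ≤ |g t|) ∧
      ∀ t ∈ Icc (0 : ℝ) 1, prim h t = fold (prim g t) := by
  have hac : AbsolutelyContinuousOnInterval (fun t => fold (prim g t)) 0 1 :=
    lipschitzWith_fold.comp_absolutelyContinuousOnInterval (absolutelyContinuousOnInterval_prim hg)
  have hle : ∀ᵐ t ∂unitMeasure, |deriv (fun t => fold (prim g t)) t| ≤ |g t| := by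
    filter_upwards [deriv_prim_ae hg, ae_unit_mem,
      ae_restrict_of_ae (absolutelyContinuousOnInterval_prim hg).ae_differentiableAt]
      with t h1 h2 h3
    rw [← h1]
    exact abs_deriv_comp_le lipschitzWith_fold
      (h3 (by simpa using ⟨h2.1.le, h2.2.le⟩))
  have hmem : MemLp (deriv fun t => fold (prim g t)) 2 unitMeasure :=
    hg.of_le (measurable_deriv _).aestronglyMeasurable hle
  refine ⟨_, hmem, hle, prim_deriv_eqOn ⟨hac, hmem, ?_⟩⟩
  have := Real.pi_pos
  simp [prim, fold]
  positivity

theorem integral_add_add {α : Type*} [MeasurableSpace α] {μ : Measure α} {f g h : α → ℝ}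
    (hf : Integrable f μ) (hg : Integrable g μ) (hh : Integrable h μ) :
    ∫ x, (f x + g x + h x) ∂μ = ∫ x, f x ∂μ + ∫ x, g x ∂μ + ∫ x, h x ∂μ := by
  rw [← integral_add hf hg]
  exact integral_add (hf.add hg) hh

/-! ### Energy and existence of minimisers by the direct method. -/

/-- `B` is a measurable hardness with values in `[a, b]`. -/
structure IsHardness (a b : ℝ) (B : ℝ → ℝ) : Prop where
  aestronglyMeasurable : AEStronglyMeasurable B unitMeasure
  mem : ∀ᵐ t ∂unitMeasure, B t ∈ Icc a b

/-- The energy of the phase with derivative `g`. -/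
noncomputable def energy (B g : ℝ → ℝ) : ℝ :=
  (1 / 2) * (∫ t, B t * g t ^ 2 ∂unitMeasure) + ∫ t, (1 - t) * Real.sin (prim g t) ∂unitMeasure

/-- `g` minimises the energy in `L²(0, 1)`. -/
def IsEnergyMin (B g : ℝ → ℝ) : Prop :=
  MemLp g 2 unitMeasure ∧ ∀ h, MemLp h 2 unitMeasure → energy B g ≤ energy B h

theorem IsHardness.memLp_mul {a b : ℝ} {B g : ℝ → ℝ} (ha : 0 < a) (hB : IsHardness a b B)
    (hg : MemLp g 2 unitMeasure) : MemLp (fun t => B t * g t) 2 unitMeasure := by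
  refine hg.of_le_mul (c := b) (hB.aestronglyMeasurable.mul hg.1) ?_
  filter_upwards [hB.mem] with t ht
  rw [norm_mul, Real.norm_eq_abs, abs_of_pos (ha.trans_le ht.1)]
  exact mul_le_mul_of_nonneg_right ht.2 (norm_nonneg _)

theorem IsHardness.integrable_mul_mul {a b : ℝ} {B g h : ℝ → ℝ} (ha : 0 < a)
    (hB : IsHardness a b B) (hg : MemLp g 2 unitMeasure) (hh : MemLp h 2 unitMeasure) :
    Integrable (fun t => B t * g t * h t) unitMeasure :=
  (hB.memLp_mul ha hg).integrable_mul hh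

theorem IsHardness.integrable_mul_sq {a b : ℝ} {B g : ℝ → ℝ} (ha : 0 < a)
    (hB : IsHardness a b B) (hg : MemLp g 2 unitMeasure) :
    Integrable (fun t => B t * g t ^ 2) unitMeasure := by
  simpa [sq, mul_assoc] using hB.integrable_mul_mul ha hg hg

theorem abs_integral_load_le_one {K : ℝ → ℝ} {f : ℝ → ℝ} (hf : ∀ x, |f x| ≤ 1) :
    |∫ t, (1 - t) * f (K t) ∂unitMeasure| ≤ 1 := by
  have := norm_integral_le_of_norm_le_const (μ := unitMeasure) (C := 1)
    (f := fun t => (1 - t) * f (K t)) ?_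
  · simpa using this
  · filter_upwards [ae_unit_mem] with t ht
    rw [Real.norm_eq_abs, abs_mul, abs_of_pos (by linarith [ht.2])]
    nlinarith [hf (K t), abs_nonneg (f (K t)), ht.1, ht.2]

/-- Coercivity: `B ≥ a`, and the load term is at least `-1`. -/
theorem IsHardness.integral_sq_le {a b : ℝ} {B g : ℝ → ℝ} (ha : 0 < a) (hB : IsHardness a b B)
    (hg : MemLp g 2 unitMeasure) : a * ∫ t, g t ^ 2 ∂unitMeasure ≤ 2 * (energy B g + 1) := by
  have h1 : ∫ t, a * g t ^ 2 ∂unitMeasure ≤ ∫ t, B t * g t ^ 2 ∂unitMeasure := by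
    refine integral_mono_ae (hg.integrable_sq.const_mul a) (hB.integrable_mul_sq ha hg) ?_
    filter_upwards [hB.mem] with t ht
    exact mul_le_mul_of_nonneg_right ht.1 (sq_nonneg _)
  rw [integral_const_mul] at h1
  have h2 := (abs_le.1 (abs_integral_load_le_one (K := prim g) Real.abs_sin_le_one)).1
  rw [energy]
  linarith

theorem tendsto_prim_of_weak {g : ℕ → ℝ → ℝ} {g₀ : ℝ → ℝ}
    (h : ∀ u : ℝ → ℝ, MemLp u 2 unitMeasure →
      Tendsto (fun n => ∫ t, g n t * u t ∂unitMeasure) atTop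
        (𝓝 (∫ t, g₀ t * u t ∂unitMeasure))) {t : ℝ} (ht : t ∈ Icc (0 : ℝ) 1) :
    Tendsto (fun n => prim (g n) t) atTop (𝓝 (prim g₀ t)) := by
  simp only [prim_eq_integral_step _ ht]
  exact h _ (memLp_step t)

/-- Weak lower semicontinuity of the energy along sequences with convergent energies. -/
theorem IsHardness.energy_le_of_weak {a b : ℝ} {B : ℝ → ℝ} (ha : 0 < a) (hB : IsHardness a b B)
    {g : ℕ → ℝ → ℝ} {g₀ : ℝ → ℝ} (hg : ∀ n, MemLp (g n) 2 unitMeasure)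
    (hg₀ : MemLp g₀ 2 unitMeasure)
    (h : ∀ u : ℝ → ℝ, MemLp u 2 unitMeasure →
      Tendsto (fun n => ∫ t, g n t * u t ∂unitMeasure) atTop
        (𝓝 (∫ t, g₀ t * u t ∂unitMeasure))) {I : ℝ}
    (hI : Tendsto (fun n => energy B (g n)) atTop (𝓝 I)) : energy B g₀ ≤ I := by
  have hload := tendsto_integral_load Real.continuous_sin Real.abs_sin_le_one
    (fun n => continuousOn_prim (hg n)) (fun t ht => tendsto_prim_of_weak h ht)
  have hlin := h _ (hB.memLp_mul ha hg₀)
  have hlim := ((hlin.const_mul 2).sub_const (∫ t, B t * g₀ t ^ 2 ∂unitMeasure)).const_mul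
    (1 / 2 : ℝ) |>.add hload
  have heq : ∫ t, g₀ t * (B t * g₀ t) ∂unitMeasure = ∫ t, B t * g₀ t ^ 2 ∂unitMeasure := by
    congr 1; ext t; ring
  rw [heq, two_mul, add_sub_cancel_right] at hlim
  refine le_of_tendsto_of_tendsto' hlim hI fun n => ?_
  rw [energy]
  have hi := (hg n).integrable_mul (hB.memLp_mul ha hg₀)
  -- Integrated form of `0 ≤ B (g n - g₀)²`: the quadratic term lies above its tangent at `g₀`,
  -- which is linear in `g n`.
  have : 2 * ∫ t, g n t * (B t * g₀ t) ∂unitMeasure - ∫ t, B t * g₀ t ^ 2 ∂unitMeasure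
      ≤ ∫ t, B t * g n t ^ 2 ∂unitMeasure := by
    rw [tsub_le_iff_right, ← integral_add (hB.integrable_mul_sq ha (hg n))
      (hB.integrable_mul_sq ha hg₀), ← integral_const_mul]
    refine integral_mono_ae (hi.const_mul 2)
      ((hB.integrable_mul_sq ha (hg n)).add (hB.integrable_mul_sq ha hg₀)) ?_
    filter_upwards [hB.mem] with t ht
    have h2 := mul_nonneg (ha.le.trans ht.1) (sq_nonneg (g n t - g₀ t))
    have h3 : 2 * (g n t * (B t * g₀ t)) ≤ B t * g n t ^ 2 + B t * g₀ t ^ 2 := by nlinarith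
    exact h3
  linarith

theorem IsHardness.exists_isEnergyMin {a b : ℝ} {B : ℝ → ℝ} (ha : 0 < a)
    (hB : IsHardness a b B) : ∃ g, IsEnergyMin B g := by
  set S : Set ℝ := energy B '' {g | MemLp g 2 unitMeasure} with hS
  have hne : S.Nonempty := ⟨_, 0, MemLp.zero, rfl⟩
  have hbdd : BddBelow S := by
    refine ⟨-1, ?_⟩
    rintro _ ⟨g, hg, rfl⟩
    have h1 := hB.integral_sq_le ha hg
    have h2 : 0 ≤ ∫ t, g t ^ 2 ∂unitMeasure := integral_nonneg fun t => sq_nonneg _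
    nlinarith
  obtain ⟨u, -, hu, huS⟩ := exists_seq_tendsto_sInf hne hbdd
  choose g hg hgu using huS
  simp only [mem_ofPred_eq] at hg
  obtain ⟨C, hC⟩ := hu.bddAbove_range
  have hbound : ∀ n, ∫ t, g n t ^ 2 ∂unitMeasure ≤ 2 * (C + 1) / a := by
    intro n
    rw [le_div_iff₀' ha]
    have h1 := hB.integral_sq_le ha (hg n)
    rw [hgu] at h1
    linarith [hC ⟨n, rfl⟩]
  obtain ⟨g₀, hg₀, φ, hφ, hlim⟩ := exists_weak_limit hg hbound
  refine ⟨g₀, hg₀, fun h hh => ?_⟩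
  have hle := hB.energy_le_of_weak ha (fun n => hg (φ n)) hg₀ hlim (I := sInf S)
    (by simpa only [hgu, Function.comp_def] using hu.comp hφ.tendsto_atTop)
  exact hle.trans (csInf_le hbdd ⟨h, hh, rfl⟩)

/-! ### Range of the minimisers. -/

theorem IsHardness.integral_mul_sq_mono {a b : ℝ} {B g h : ℝ → ℝ} (ha : 0 < a)
    (hB : IsHardness a b B) (hg : MemLp g 2 unitMeasure) (hh : MemLp h 2 unitMeasure)
    (hle : ∀ᵐ t ∂unitMeasure, |h t| ≤ |g t|) :
    ∫ t, B t * h t ^ 2 ∂unitMeasure ≤ ∫ t, B t * g t ^ 2 ∂unitMeasure := by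
  refine integral_mono_ae (hB.integrable_mul_sq ha hh) (hB.integrable_mul_sq ha hg) ?_
  filter_upwards [hB.mem, hle] with t ht h1
  exact mul_le_mul_of_nonneg_left (sq_le_sq.2 h1) (ha.le.trans ht.1)

theorem integral_load_fold_le {g h : ℝ → ℝ} (hg : MemLp g 2 unitMeasure)
    (hh : MemLp h 2 unitMeasure) (hfold : ∀ t ∈ Icc (0 : ℝ) 1, prim h t = fold (prim g t)) :
    ∫ t, (1 - t) * Real.sin (prim h t) ∂unitMeasure
      ≤ ∫ t, (1 - t) * Real.sin (prim g t) ∂unitMeasure := by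
  refine integral_mono_ae (integrable_load (continuousOn_prim hh) Real.continuous_sin)
    (integrable_load (continuousOn_prim hg) Real.continuous_sin) ?_
  filter_upwards [ae_unit_mem] with t ht
  rw [hfold t (Ioo_subset_Icc_self ht)]
  exact mul_le_mul_of_nonneg_left (sin_fold_le _) (by linarith [ht.2])

theorem IsHardness.exists_fold_energy_le {a b : ℝ} {B g : ℝ → ℝ} (ha : 0 < a)
    (hB : IsHardness a b B) (hg : MemLp g 2 unitMeasure) :
    ∃ h, MemLp h 2 unitMeasure ∧ energy B h ≤ energy B g ∧
      ∀ t ∈ Icc (0 : ℝ) 1, prim h t ∈ Icc (-(Real.pi / 2)) 0 := by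
  obtain ⟨h, hh, hle, hfold⟩ := exists_fold hg
  refine ⟨h, hh, ?_, fun t ht => hfold t ht ▸ fold_mem _⟩
  have h1 := hB.integral_mul_sq_mono ha hg hh hle
  have h2 := integral_load_fold_le hg hh hfold
  rw [energy, energy]
  linarith

/-- A continuous path from `0` that leaves `[-π/2, 0]` must cross values where folding strictly
lowers `sin`. -/
theorem mem_Icc_of_sin_fold_eq {G : ℝ → ℝ} (hG : ContinuousOn G (Icc 0 1)) (h0 : G 0 = 0)
    (h : ∀ t ∈ Icc (0 : ℝ) 1, Real.sin (fold (G t)) = Real.sin (G t)) {t : ℝ}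
    (ht : t ∈ Icc (0 : ℝ) 1) : G t ∈ Icc (-(Real.pi / 2)) 0 := by
  have hpi := Real.pi_pos
  have hGt : ContinuousOn G (Icc 0 t) := hG.mono (Icc_subset_Icc_right ht.2)
  constructor
  · by_contra! hlt
    -- Truncation at `-π` keeps `G s` in `[-π, -π/2)`, where `sin > -1`; the value `G t` itself
    -- could be a distant minimum point of `sin`.
    obtain ⟨s, hs, hsv⟩ := intermediate_value_Icc' ht.1 hGt
      (show max (G t) (-Real.pi) ∈ Icc (G t) (G 0) from
        ⟨le_max_left _ _, by rw [h0]; exact max_le (by linarith) (by linarith)⟩)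
    have h1 := h s ⟨hs.1, hs.2.trans ht.2⟩
    have hlo : -Real.pi ≤ G s := hsv ▸ le_max_right _ _
    have hhi : G s < -(Real.pi / 2) := hsv ▸ max_lt hlt (by linarith)
    rw [fold, max_eq_right (by rw [abs_of_neg (by linarith)]; linarith), Real.sin_neg,
      Real.sin_pi_div_two] at h1
    have h2 : Real.cos (G s + Real.pi / 2) = 1 := by
      rw [Real.cos_add_pi_div_two, ← h1, neg_neg]
    have := (Real.cos_eq_one_iff_of_lt_of_lt (by linarith) (by linarith)).1 h2
    linarith
  · by_contra! hlt
    obtain ⟨s, hs, hsv⟩ := intermediate_value_Icc ht.1 hGt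
      (show min (G t) (Real.pi / 2) ∈ Icc (G 0) (G t) from
        ⟨by rw [h0]; exact le_min hlt.le (by linarith), min_le_left _ _⟩)
    have hpos : 0 < G s := hsv ▸ lt_min hlt (by linarith)
    have hhi : G s ≤ Real.pi / 2 := hsv ▸ min_le_right _ _
    exact hpos.not_ge (nonpos_of_sin_fold_eq (h s ⟨hs.1, hs.2.trans ht.2⟩)
      (by rwa [abs_of_pos hpos]))

/-- Global minimisers take their values in `[-π/2, 0]`, where the energy is convex. -/
theorem IsEnergyMin.prim_mem_Icc {a b : ℝ} {B g : ℝ → ℝ} (ha : 0 < a) (hB : IsHardness a b B)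
    (hg : IsEnergyMin B g) {t : ℝ} (ht : t ∈ Icc (0 : ℝ) 1) :
    prim g t ∈ Icc (-(Real.pi / 2)) 0 := by
  obtain ⟨h, hh, hle, hfold⟩ := exists_fold hg.1
  have h1 := hB.integral_mul_sq_mono ha hg.1 hh hle
  have h2 := integral_load_fold_le hg.1 hh hfold
  have h3 := hg.2 h hh
  rw [energy, energy] at h3
  have hig := integrable_load (continuousOn_prim hg.1) Real.continuous_sin
  have hih := integrable_load (continuousOn_prim hh) Real.continuous_sin
  have hid : Integrable (fun t => (1 - t) * Real.sin (prim g t) - (1 - t) * Real.sin (prim h t))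
      unitMeasure := hig.sub hih
  -- Folding raises neither term of the energy, so minimality forces equality of the load terms;
  -- continuity then gives `sin (prim h) = sin (prim g)` everywhere on `[0, 1]`.
  have hzero : ∫ t, ((1 - t) * Real.sin (prim g t) - (1 - t) * Real.sin (prim h t))
      ∂unitMeasure = 0 := by
    rw [integral_sub hig hih]; linarith
  rw [integral_eq_zero_iff_of_nonneg_ae _ hid] at hzero
  · have hae : (fun t => Real.sin (prim h t)) =ᵐ[volume.restrict (Icc 0 1)]
        fun t => Real.sin (prim g t) := by
      rw [restrict_Ioo_eq_restrict_Icc.symm]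
      filter_upwards [hzero, ae_unit_mem] with t ht hmem
      have h4 : (1 - t) * (Real.sin (prim g t) - Real.sin (prim h t)) = 0 := by
        simpa [mul_sub] using ht
      rcases mul_eq_zero.1 h4 with h5 | h5
      · linarith [hmem.2]
      · linarith
    have heq := Measure.eqOn_Icc_of_ae_eq volume (zero_ne_one) hae
      (Real.continuous_sin.comp_continuousOn (continuousOn_prim hh))
      (Real.continuous_sin.comp_continuousOn (continuousOn_prim hg.1))
    refine mem_Icc_of_sin_fold_eq (continuousOn_prim hg.1) (by simp [prim]) (fun s hs => ?_) ht
    rw [← hfold s hs]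
    exact heq hs
  · filter_upwards [ae_unit_mem] with t ht
    rw [hfold t (Ioo_subset_Icc_self ht), ← mul_sub]
    exact mul_nonneg (by linarith [ht.2]) (sub_nonneg.2 (sin_fold_le _))

/-! ### The moment of the load and the Euler-Lagrange equation. -/

/-- The density of the moment of the load. -/
noncomputable def momentDensity (g : ℝ → ℝ) (t : ℝ) : ℝ := (1 - t) * Real.cos (prim g t)

/-- The moment `∫ s in t..1, (1 - s) cos (prim g s)`. -/
noncomputable def moment (g : ℝ → ℝ) (t : ℝ) : ℝ :=
  prim (momentDensity g) 1 - prim (momentDensity g) t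

theorem abs_momentDensity_le (g : ℝ → ℝ) : ∀ᵐ t ∂unitMeasure, |momentDensity g t| ≤ 1 := by
  filter_upwards [ae_unit_mem] with t ht
  rw [momentDensity, abs_mul, abs_of_pos (by linarith [ht.2])]
  nlinarith [Real.abs_cos_le_one (prim g t), abs_nonneg (Real.cos (prim g t)), ht.1, ht.2]

theorem memLp_momentDensity {g : ℝ → ℝ} (hg : MemLp g 2 unitMeasure) :
    MemLp (momentDensity g) 2 unitMeasure :=
  MemLp.of_bound (integrable_load (continuousOn_prim hg) Real.continuous_cos).aestronglyMeasurable
    1 (abs_momentDensity_le g)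

theorem abs_prim_momentDensity_le (g : ℝ → ℝ) {t : ℝ} (ht : t ∈ Icc (0 : ℝ) 1) :
    |prim (momentDensity g) t| ≤ 1 := by
  rw [prim_eq_integral_step _ ht]
  have := norm_integral_le_of_norm_le_const (μ := unitMeasure) (C := 1)
    (f := fun s => momentDensity g s * step t s) ?_
  · simpa using this
  · filter_upwards [abs_momentDensity_le g] with s hs
    by_cases h : s ∈ Iic t <;> simp [step, h, hs]

theorem abs_moment_le (g : ℝ → ℝ) {t : ℝ} (ht : t ∈ Icc (0 : ℝ) 1) : |moment g t| ≤ 2 :=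
  (abs_sub _ _).trans (by
    linarith [abs_prim_momentDensity_le g ht,
      abs_prim_momentDensity_le g (t := 1) (by simp)])

theorem continuousOn_moment {g : ℝ → ℝ} (hg : MemLp g 2 unitMeasure) :
    ContinuousOn (moment g) (Icc 0 1) :=
  continuousOn_const.sub (continuousOn_prim (memLp_momentDensity hg))

theorem memLp_moment {g : ℝ → ℝ} (hg : MemLp g 2 unitMeasure) :
    MemLp (moment g) 2 unitMeasure := by
  refine MemLp.of_bound (aestronglyMeasurable_of_continuousOn (continuousOn_moment hg)) 2 ?_
  filter_upwards [ae_unit_mem] with t ht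
  exact abs_moment_le g (Ioo_subset_Icc_self ht)

/-- Integration by parts; the boundary terms vanish because `moment g 1 = 0` and `prim h 0 = 0`. -/
theorem integral_momentDensity_mul_prim {g h : ℝ → ℝ} (hg : MemLp g 2 unitMeasure)
    (hh : MemLp h 2 unitMeasure) :
    ∫ t, momentDensity g t * prim h t ∂unitMeasure = ∫ t, moment g t * h t ∂unitMeasure := by
  have hm := memLp_momentDensity hg
  have hparts := (absolutelyContinuousOnInterval_prim hm).integral_mul_deriv_eq_deriv_mul
    (absolutelyContinuousOnInterval_prim hh)
  rw [intervalIntegral_eq_integral_unit, intervalIntegral_eq_integral_unit] at hparts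
  have h1 : ∫ t, prim (momentDensity g) t * deriv (prim h) t ∂unitMeasure
      = ∫ t, prim (momentDensity g) t * h t ∂unitMeasure := by
    refine integral_congr_ae ?_
    filter_upwards [deriv_prim_ae hh] with t ht
    rw [ht]
  have h2 : ∫ t, deriv (prim (momentDensity g)) t * prim h t ∂unitMeasure
      = ∫ t, momentDensity g t * prim h t ∂unitMeasure := by
    refine integral_congr_ae ?_
    filter_upwards [deriv_prim_ae hm] with t ht
    rw [ht]
  have hint : Integrable (fun t => prim (momentDensity g) t * h t) unitMeasure := by
    have := (memLp_moment hg).integrable_mul hh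
    refine (((hh.integrable (by norm_num)).const_mul (prim (momentDensity g) 1)).sub this).congr ?_
    refine Eventually.of_forall fun t => ?_
    simp [moment]; ring
  have h3 : ∫ t, moment g t * h t ∂unitMeasure
      = prim (momentDensity g) 1 * prim h 1 - ∫ t, prim (momentDensity g) t * h t ∂unitMeasure := by
    simp only [moment, sub_mul]
    rw [integral_sub ((hh.integrable (by norm_num)).const_mul _) hint, integral_const_mul]
    congr 2
    exact (intervalIntegral_eq_integral_unit h).symm
  rw [h1, h2] at hparts
  rw [h3, hparts]
  simp [prim]

theorem integrable_momentDensity_mul_prim {g h : ℝ → ℝ} (hg : MemLp g 2 unitMeasure)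
    (hh : MemLp h 2 unitMeasure) :
    Integrable (fun t => momentDensity g t * prim h t) unitMeasure := by
  have hc : ContinuousOn (fun t => (1 - t) * Real.cos (prim g t) * prim h t) (Icc 0 1) :=
    ((by fun_prop : ContinuousOn (fun t : ℝ => 1 - t) (Icc 0 1)).mul
      (Real.continuous_cos.comp_continuousOn (continuousOn_prim hg))).mul (continuousOn_prim hh)
  exact (hc.integrableOn_Icc).mono_set Ioo_subset_Icc_self

/-- The constant 3 is not sharp: 2 comes from `sin y - y` and 1 from `cos y - 1`. Only a quadratic
remainder matters. -/
theorem sin_add_le (x y : ℝ) : Real.sin (x + y) ≤ Real.sin x + y * Real.cos x + 3 * y ^ 2 := by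
  have hs : |Real.sin y - y| ≤ 2 * y ^ 2 := by
    rcases le_total |y| 1 with h | h
    · have h1 := Real.sin_bound h
      have h3 : |y ^ 3| ≤ y ^ 2 := by
        rw [abs_pow, ← sq_abs y]; exact pow_le_pow_of_le_one (abs_nonneg y) h (by norm_num)
      have h4 : |y| ^ 5 ≤ y ^ 2 := by
        rw [← sq_abs y]; exact pow_le_pow_of_le_one (abs_nonneg y) h (by norm_num)
      rw [abs_le] at h1 h3 ⊢
      constructor <;> linarith [h1.1, h1.2, h3.1, h3.2, sq_nonneg y]
    · have h1 : |Real.sin y - y| ≤ |Real.sin y| + |y| := abs_sub _ _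
      have h2 := Real.abs_sin_le_one y
      rw [← sq_abs y]
      nlinarith
  have hc : |Real.cos y - 1| ≤ y ^ 2 := by
    rw [abs_le]
    constructor <;> nlinarith [Real.one_sub_sq_div_two_le_cos (x := y), Real.cos_le_one y]
  have h1 : Real.sin x * (Real.cos y - 1) ≤ y ^ 2 :=
    (le_abs_self _).trans (by
      rw [abs_mul]
      nlinarith [Real.abs_sin_le_one x, abs_nonneg (Real.sin x), abs_nonneg (Real.cos y - 1)])
  have h2 : Real.cos x * (Real.sin y - y) ≤ 2 * y ^ 2 :=
    (le_abs_self _).trans (by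
      rw [abs_mul]
      nlinarith [Real.abs_cos_le_one x, abs_nonneg (Real.cos x), abs_nonneg (Real.sin y - y)])
  rw [Real.sin_add]
  linarith

/-- A one-sided quadratic bound in `ε` replaces differentiation of the energy. -/
theorem IsHardness.energy_add_le {a b : ℝ} {B g h : ℝ → ℝ} (ha : 0 < a) (hB : IsHardness a b B)
    (hg : MemLp g 2 unitMeasure) (hh : MemLp h 2 unitMeasure) (ε : ℝ) :
    energy B (fun t => g t + ε * h t) ≤ energy B g
      + ε * (∫ t, (B t * g t + moment g t) * h t ∂unitMeasure)
      + ε ^ 2 * ((1 / 2) * ∫ t, B t * h t ^ 2 ∂unitMeasure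
        + ∫ t, 3 * ((1 - t) * prim h t ^ 2) ∂unitMeasure) := by
  have hgh : MemLp (fun t => g t + ε * h t) 2 unitMeasure := hg.add (hh.const_mul ε)
  have e1 : ∫ t, B t * (g t + ε * h t) ^ 2 ∂unitMeasure
      = ∫ t, B t * g t ^ 2 ∂unitMeasure + 2 * ε * ∫ t, B t * g t * h t ∂unitMeasure
        + ε ^ 2 * ∫ t, B t * h t ^ 2 ∂unitMeasure := by
    have i1 := hB.integrable_mul_sq ha hg
    have i2 := (hB.integrable_mul_mul ha hg hh).const_mul (2 * ε)
    have i3 := (hB.integrable_mul_sq ha hh).const_mul (ε ^ 2)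
    rw [← integral_const_mul, ← integral_const_mul, ← integral_add_add i1 i2 i3]
    congr 1; ext t; ring
  have hmh : Integrable (fun t => moment g t * h t) unitMeasure :=
    (memLp_moment hg).integrable_mul hh
  have e2 : ∫ t, (B t * g t + moment g t) * h t ∂unitMeasure
      = ∫ t, B t * g t * h t ∂unitMeasure + ∫ t, momentDensity g t * prim h t ∂unitMeasure := by
    rw [integral_momentDensity_mul_prim hg hh,
      ← integral_add (hB.integrable_mul_mul ha hg hh) hmh]
    congr 1; ext t; ring
  have hsq : Integrable (fun t => 3 * ((1 - t) * prim h t ^ 2)) unitMeasure :=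
    (integrable_load (f := fun x => x ^ 2) (continuousOn_prim hh) (by fun_prop)).const_mul 3
  have hsin := integrable_load (continuousOn_prim hg) Real.continuous_sin
  have hmom := integrable_momentDensity_mul_prim hg hh
  have e3 : ∫ t, (1 - t) * Real.sin (prim (fun t => g t + ε * h t) t) ∂unitMeasure
      ≤ ∫ t, (1 - t) * Real.sin (prim g t) ∂unitMeasure
        + ε * ∫ t, momentDensity g t * prim h t ∂unitMeasure
        + ε ^ 2 * ∫ t, 3 * ((1 - t) * prim h t ^ 2) ∂unitMeasure := by
    rw [← integral_const_mul, ← integral_const_mul, 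
      ← integral_add_add hsin (hmom.const_mul ε) (hsq.const_mul _)]
    refine integral_mono_ae (integrable_load (continuousOn_prim hgh) Real.continuous_sin)
      ((hsin.add (hmom.const_mul ε)).add (hsq.const_mul _)) ?_
    filter_upwards [ae_unit_mem] with t ht
    rw [prim_add_const_mul hg hh ε (Ioo_subset_Icc_self ht)]
    simp only [momentDensity]
    have := mul_le_mul_of_nonneg_left (sin_add_le (prim g t) (ε * prim h t))
      (show 0 ≤ 1 - t by linarith [ht.2])
    refine this.trans (le_of_eq ?_)
    ring
  rw [energy, energy, e1, e2]
  linarith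

/-- The Euler-Lagrange equation `B K' = -∫ s in t..1, (1 - s) cos (K s)`. -/
theorem IsEnergyMin.euler_lagrange {a b : ℝ} {B g : ℝ → ℝ} (ha : 0 < a) (hB : IsHardness a b B)
    (hg : IsEnergyMin B g) : ∀ᵐ t ∂unitMeasure, B t * g t = -moment g t := by
  have hzero := ae_eq_zero_of_forall_integral_mul_eq_zero
    ((hB.memLp_mul ha hg.1).add (memLp_moment hg.1)) (fun u hu => ?_)
  · filter_upwards [hzero] with t ht
    have : B t * g t + moment g t = 0 := ht
    linarith
  -- At a minimiser the quadratic in `ε`, with zero constant term, is nonnegative; its discriminant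
  -- is the square of the first variation.
  · have hquad := discrim_le_zero (K := ℝ)
      (a := (1 / 2) * ∫ t, B t * u t ^ 2 ∂unitMeasure
        + ∫ t, 3 * ((1 - t) * prim u t ^ 2) ∂unitMeasure)
      (b := ∫ t, (B t * g t + moment g t) * u t ∂unitMeasure) (c := 0) (fun ε => by
        have h1 := hB.energy_add_le ha hg.1 hu ε
        have h2 := hg.2 _ (hg.1.add (hu.const_mul ε))
        have h3 : energy B g ≤ energy B (fun t => g t + ε * u t) := h2
        linarith)
    rw [discrim, mul_zero, sub_zero] at hquad
    exact pow_eq_zero_iff two_ne_zero |>.1 (le_antisymm hquad (sq_nonneg _))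

/-! ### Convexity and uniqueness. -/

/-- `cos` is increasing on `[-π/2, 0]`, so `sin` is convex there; the mean value theorem gives the
tangent inequality. -/
theorem sin_tangent_le {x y : ℝ} (hx : x ∈ Icc (-(Real.pi / 2)) 0)
    (hy : y ∈ Icc (-(Real.pi / 2)) 0) :
    Real.sin x + Real.cos x * (y - x) ≤ Real.sin y := by
  have hmono : ∀ u ∈ Icc (-(Real.pi / 2)) (0 : ℝ), ∀ v ∈ Icc (-(Real.pi / 2)) (0 : ℝ), u ≤ v →
      Real.cos u ≤ Real.cos v := by
    intro u hu v hv huv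
    rw [← Real.cos_neg u, ← Real.cos_neg v]
    exact Real.cos_le_cos_of_nonneg_of_le_pi (by linarith [hv.2])
      (by linarith [hu.1, Real.pi_pos]) (by linarith)
  rcases lt_trichotomy x y with h | h | h
  · obtain ⟨z, hz, hz'⟩ := exists_deriv_eq_slope Real.sin h Real.continuous_sin.continuousOn
      Real.differentiable_sin.differentiableOn
    rw [Real.deriv_sin, eq_div_iff (by linarith)] at hz'
    have := hmono x hx z ⟨by linarith [hx.1, hz.1], by linarith [hy.2, hz.2]⟩ hz.1.le
    nlinarith
  · subst h; simp
  · obtain ⟨z, hz, hz'⟩ := exists_deriv_eq_slope Real.sin h Real.continuous_sin.continuousOn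
      Real.differentiable_sin.differentiableOn
    rw [Real.deriv_sin, eq_div_iff (by linarith)] at hz'
    have := hmono z ⟨by linarith [hy.1, hz.1], by linarith [hx.2, hz.2]⟩ x hx hz.2.le
    nlinarith

/-- Strong convexity of the energy at a solution of the Euler-Lagrange equation. -/
theorem IsHardness.energy_add_integral_le {a b : ℝ} {B g h : ℝ → ℝ} (ha : 0 < a)
    (hB : IsHardness a b B) (hg : MemLp g 2 unitMeasure) (hh : MemLp h 2 unitMeasure)
    (hgr : ∀ t ∈ Icc (0 : ℝ) 1, prim g t ∈ Icc (-(Real.pi / 2)) 0)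
    (hhr : ∀ t ∈ Icc (0 : ℝ) 1, prim h t ∈ Icc (-(Real.pi / 2)) 0)
    (hel : ∀ᵐ t ∂unitMeasure, B t * g t = -moment g t) :
    energy B g + (1 / 2) * ∫ t, B t * (h t - g t) ^ 2 ∂unitMeasure ≤ energy B h := by
  have hd : MemLp (fun t => h t - g t) 2 unitMeasure := hh.sub hg
  have hdp : ∀ t ∈ Icc (0 : ℝ) 1, prim (fun t => h t - g t) t = prim h t - prim g t := by
    intro t ht
    have := prim_add_const_mul hh hg (-1) ht
    simp only [neg_one_mul, ← sub_eq_add_neg] at this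
    exact this
  have i1 := hB.integrable_mul_sq ha hg
  have i2 := (hB.integrable_mul_mul ha hg hd).const_mul 2
  have i3 := hB.integrable_mul_sq ha hd
  have e1 : ∫ t, B t * h t ^ 2 ∂unitMeasure
      = ∫ t, B t * g t ^ 2 ∂unitMeasure + 2 * ∫ t, B t * g t * (h t - g t) ∂unitMeasure
        + ∫ t, B t * (h t - g t) ^ 2 ∂unitMeasure := by
    rw [← integral_const_mul, ← integral_add_add i1 i2 i3]
    congr 1; ext t; ring
  -- By the Euler-Lagrange equation, the first-order part of the elastic term cancels that of the
  -- load in `e3`.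
  have e2 : ∫ t, B t * g t * (h t - g t) ∂unitMeasure
      = -∫ t, momentDensity g t * prim (fun t => h t - g t) t ∂unitMeasure := by
    rw [integral_momentDensity_mul_prim hg hd, ← integral_neg]
    refine integral_congr_ae ?_
    filter_upwards [hel] with t ht
    rw [ht, neg_mul]
  have hsin := integrable_load (continuousOn_prim hg) Real.continuous_sin
  have hmom := integrable_momentDensity_mul_prim hg hd
  have e3 : ∫ t, (1 - t) * Real.sin (prim g t) ∂unitMeasure
      + ∫ t, momentDensity g t * prim (fun t => h t - g t) t ∂unitMeasure
      ≤ ∫ t, (1 - t) * Real.sin (prim h t) ∂unitMeasure := by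
    rw [← integral_add hsin hmom]
    refine integral_mono_ae (hsin.add hmom)
      (integrable_load (continuousOn_prim hh) Real.continuous_sin) ?_
    filter_upwards [ae_unit_mem] with t ht
    have ht' := Ioo_subset_Icc_self ht
    simp only [momentDensity]
    rw [hdp t ht', mul_assoc, ← mul_add]
    exact mul_le_mul_of_nonneg_left (sin_tangent_le (hgr t ht') (hhr t ht'))
      (by linarith [ht.2])
  rw [energy, energy, e1, e2]
  linarith

theorem IsHardness.integral_mul_sq_nonneg {a b : ℝ} {B : ℝ → ℝ} (ha : 0 < a)
    (hB : IsHardness a b B) (g : ℝ → ℝ) : 0 ≤ ∫ t, B t * g t ^ 2 ∂unitMeasure := by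
  refine integral_nonneg_of_ae ?_
  filter_upwards [hB.mem] with t ht
  exact mul_nonneg (ha.le.trans ht.1) (sq_nonneg _)

/-- An arbitrary competitor is folded first, so that the convexity gap applies to it. -/
theorem IsHardness.isEnergyMin_of_euler_lagrange {a b : ℝ} {B g : ℝ → ℝ} (ha : 0 < a)
    (hB : IsHardness a b B) (hg : MemLp g 2 unitMeasure)
    (hgr : ∀ t ∈ Icc (0 : ℝ) 1, prim g t ∈ Icc (-(Real.pi / 2)) 0)
    (hel : ∀ᵐ t ∂unitMeasure, B t * g t = -moment g t) : IsEnergyMin B g := by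
  refine ⟨hg, fun h hh => ?_⟩
  obtain ⟨k, hk, hle, hkr⟩ := hB.exists_fold_energy_le ha hh
  have h1 := hB.energy_add_integral_le ha hg hk hgr hkr hel
  have h2 := hB.integral_mul_sq_nonneg ha (fun t => k t - g t)
  linarith

theorem IsEnergyMin.ae_eq {a b : ℝ} {B g h : ℝ → ℝ} (ha : 0 < a) (hB : IsHardness a b B)
    (hg : IsEnergyMin B g) (hh : IsEnergyMin B h) : h =ᵐ[unitMeasure] g := by
  have h1 := hB.energy_add_integral_le ha hg.1 hh.1
    (fun t ht => hg.prim_mem_Icc ha hB ht) (fun t ht => hh.prim_mem_Icc ha hB ht)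
    (hg.euler_lagrange ha hB)
  have h2 := hB.integral_mul_sq_nonneg ha (fun t => h t - g t)
  have h3 := hh.2 g hg.1
  have h4 : ∫ t, B t * (h t - g t) ^ 2 ∂unitMeasure = 0 := by linarith
  have hd : MemLp (fun t => h t - g t) 2 unitMeasure := hh.1.sub hg.1
  rw [integral_eq_zero_iff_of_nonneg_ae _ (hB.integrable_mul_sq ha hd)] at h4
  · filter_upwards [h4, hB.mem] with t ht hm
    have h5 : B t * (h t - g t) ^ 2 = 0 := ht
    rcases mul_eq_zero.1 h5 with h6 | h6
    · linarith [hm.1]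
    · linarith [pow_eq_zero_iff two_ne_zero |>.1 h6]
  · filter_upwards [hB.mem] with t ht
    exact mul_nonneg (ha.le.trans ht.1) (sq_nonneg _)

/-! ### From derivatives back to phases and designs. -/

theorem phaseEnergy_eq_energy_deriv (B : ℝ → ℝ) {K : ℝ → ℝ} (hK : K ∈ W12l) :
    phaseEnergy B K = energy B (deriv K) := by
  rw [phaseEnergy, energy, intervalIntegral_eq_integral_unit, intervalIntegral_eq_integral_unit]
  congr 1
  refine integral_congr_ae ?_
  filter_upwards [ae_unit_mem] with t ht
  rw [prim_deriv_eqOn hK (Ioo_subset_Icc_self ht)]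

theorem phaseEnergy_prim (B : ℝ → ℝ) {g : ℝ → ℝ} (hg : MemLp g 2 unitMeasure) :
    phaseEnergy B (prim g) = energy B g := by
  rw [phaseEnergy, energy, intervalIntegral_eq_integral_unit, intervalIntegral_eq_integral_unit]
  congr 2
  refine integral_congr_ae ?_
  filter_upwards [deriv_prim_ae hg] with t ht
  rw [ht]

theorem IsEnergyMin.isPhaseMinimiser {B g : ℝ → ℝ} (hg : IsEnergyMin B g) :
    IsPhaseMinimiser B (prim g) := by
  refine ⟨prim_mem_W12l hg.1, fun L hL => ?_⟩
  rw [phaseEnergy_prim B hg.1, phaseEnergy_eq_energy_deriv B hL]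
  exact hg.2 _ hL.2.1

theorem IsPhaseMinimiser.isEnergyMin {B K : ℝ → ℝ} (hK : IsPhaseMinimiser B K) :
    IsEnergyMin B (deriv K) := by
  refine ⟨hK.1.2.1, fun h hh => ?_⟩
  rw [← phaseEnergy_eq_energy_deriv B hK.1, ← phaseEnergy_prim B hh]
  exact hK.2 _ (prim_mem_W12l hh)

theorem IsHardness.isPhaseMinimiser_phase {a b : ℝ} {B : ℝ → ℝ} (ha : 0 < a)
    (hB : IsHardness a b B) : IsPhaseMinimiser B (phase B) := by
  obtain ⟨g, hg⟩ := hB.exists_isEnergyMin ha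
  exact Classical.epsilon_spec ⟨_, hg.isPhaseMinimiser⟩

theorem IsHardness.eqOn_phase {a b : ℝ} {B K : ℝ → ℝ} (ha : 0 < a) (hB : IsHardness a b B)
    (hK : IsPhaseMinimiser B K) : EqOn K (phase B) (Icc 0 1) := by
  have hP := hB.isPhaseMinimiser_phase ha
  exact ((prim_deriv_eqOn hK.1).symm.trans
    (prim_congr_ae (hP.isEnergyMin.ae_eq ha hB hK.isEnergyMin))).trans (prim_deriv_eqOn hP.1)

theorem isHardness_hardness {a b : ℝ} (hab : a < b) {θ : Lp ℝ ⊤ unitMeasure}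
    (hθ : θ ∈ designs) : IsHardness a b (hardness a b θ) where
  aestronglyMeasurable := by
    have := (Lp.memLp θ).1
    exact ((aestronglyMeasurable_const.sub this).mul_const a).add (this.mul_const b)
  mem := by
    have hθ' : ∀ᵐ t ∂unitMeasure, θ t ∈ Icc (0 : ℝ) 1 := hθ
    filter_upwards [hθ'] with t ht
    constructor <;> simp only [hardness] <;> nlinarith [ht.1, ht.2]

theorem relaxedCost_eq {a b : ℝ} (ha : 0 < a) (hab : a < b) (c : ℝ)
    {θ : Lp ℝ ⊤ unitMeasure} (hθ : θ ∈ designs) {g : ℝ → ℝ}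
    (hg : IsEnergyMin (hardness a b θ) g) :
    relaxedCost a b c θ = -(∫ t, (1 - t) * Real.sin (prim g t) ∂unitMeasure)
      + c * ∫ t, θ t ∂unitMeasure := by
  rw [relaxedCost, cost, intervalIntegral_eq_integral_unit, intervalIntegral_eq_integral_unit]
  congr 2
  refine integral_congr_ae ?_
  filter_upwards [ae_unit_mem] with t ht
  rw [(isHardness_hardness hab hθ).eqOn_phase ha hg.isPhaseMinimiser (Ioo_subset_Icc_self ht)]

/-! ### Weak limits of compliances. -/

theorem ae_le_of_weak {f g : ℕ → ℝ → ℝ} {f₀ g₀ : ℝ → ℝ} (hf : ∀ n, MemLp (f n) 2 unitMeasure)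
    (hg : ∀ n, MemLp (g n) 2 unitMeasure) (hf₀ : MemLp f₀ 2 unitMeasure)
    (hg₀ : MemLp g₀ 2 unitMeasure)
    (hfl : ∀ u : ℝ → ℝ, MemLp u 2 unitMeasure →
      Tendsto (fun n => ∫ t, f n t * u t ∂unitMeasure) atTop
        (𝓝 (∫ t, f₀ t * u t ∂unitMeasure)))
    (hgl : ∀ u : ℝ → ℝ, MemLp u 2 unitMeasure →
      Tendsto (fun n => ∫ t, g n t * u t ∂unitMeasure) atTop
        (𝓝 (∫ t, g₀ t * u t ∂unitMeasure)))
    (hle : ∀ n, f n ≤ᵐ[unitMeasure] g n) : f₀ ≤ᵐ[unitMeasure] g₀ := by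
  refine ae_le_of_forall_setIntegral_le (hf₀.integrable (by norm_num))
    (hg₀.integrable (by norm_num)) fun s hs _ => ?_
  have hu : MemLp (s.indicator (1 : ℝ → ℝ)) 2 unitMeasure :=
    (memLp_const (1 : ℝ)).indicator hs
  have key : ∀ k : ℝ → ℝ, ∫ t, k t * s.indicator (1 : ℝ → ℝ) t ∂unitMeasure
      = ∫ t in s, k t ∂unitMeasure := by
    intro k
    rw [← integral_indicator hs]
    congr 1; ext t
    by_cases h : t ∈ s <;> simp [h]
  rw [← key, ← key]
  refine le_of_tendsto_of_tendsto' (hfl _ hu) (hgl _ hu) fun n => ?_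
  refine integral_mono_ae ((hf n).integrable_mul hu) ((hg n).integrable_mul hu) ?_
  filter_upwards [hle n] with t ht
  exact mul_le_mul_of_nonneg_right ht (indicator_nonneg (fun _ _ => zero_le_one) t)

theorem tendsto_moment {g : ℕ → ℝ → ℝ} {g₀ : ℝ → ℝ} (hg : ∀ n, MemLp (g n) 2 unitMeasure)
    (hlim : ∀ t ∈ Icc (0 : ℝ) 1, Tendsto (fun n => prim (g n) t) atTop (𝓝 (prim g₀ t)))
    {t : ℝ} (ht : t ∈ Icc (0 : ℝ) 1) :
    Tendsto (fun n => moment (g n) t) atTop (𝓝 (moment g₀ t)) := by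
  have key : ∀ t ∈ Icc (0 : ℝ) 1, Tendsto (fun n => prim (momentDensity (g n)) t) atTop
      (𝓝 (prim (momentDensity g₀) t)) := by
    intro t ht
    simp only [prim_eq_integral_step _ ht]
    refine tendsto_integral_of_dominated_convergence (fun _ => 1)
      (fun n => ((memLp_momentDensity (hg n)).integrable_mul
        (memLp_step t)).aestronglyMeasurable) (integrable_const 1) ?_ ?_
    · intro n
      filter_upwards [abs_momentDensity_le (g n)] with s hs
      by_cases h : s ∈ Iic t <;> simp [step, h, hs]
    · filter_upwards [ae_unit_mem] with s hs
      exact (((Real.continuous_cos.tendsto _).comp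
        (hlim s (Ioo_subset_Icc_self hs))).const_mul _).mul_const _
  exact (key 1 (by simp)).sub (key t ht)

theorem IsHardness.memLp_inv {a b : ℝ} {B : ℝ → ℝ} (ha : 0 < a) (hB : IsHardness a b B) :
    MemLp (fun t => (B t)⁻¹) 2 unitMeasure := by
  refine MemLp.of_bound hB.aestronglyMeasurable.aemeasurable.inv.aestronglyMeasurable a⁻¹ ?_
  filter_upwards [hB.mem] with t ht
  rw [norm_inv, Real.norm_eq_abs, abs_of_pos (ha.trans_le ht.1)]
  exact inv_anti₀ ha ht.1

/-- If the compliances `1 / B n` converge weakly, weak limits of minimisers are minimisers for the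
limit compliance. -/
theorem IsHardness.isEnergyMin_of_weak {a b : ℝ} (ha : 0 < a) {B g : ℕ → ℝ → ℝ}
    {B₀ g₀ : ℝ → ℝ} (hB : ∀ n, IsHardness a b (B n)) (hB₀ : IsHardness a b B₀)
    (hg : ∀ n, IsEnergyMin (B n) (g n)) (hg₀ : MemLp g₀ 2 unitMeasure)
    (hBl : ∀ u : ℝ → ℝ, MemLp u 2 unitMeasure →
      Tendsto (fun n => ∫ t, (B n t)⁻¹ * u t ∂unitMeasure) atTop
        (𝓝 (∫ t, (B₀ t)⁻¹ * u t ∂unitMeasure)))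
    (hgl : ∀ u : ℝ → ℝ, MemLp u 2 unitMeasure →
      Tendsto (fun n => ∫ t, g n t * u t ∂unitMeasure) atTop
        (𝓝 (∫ t, g₀ t * u t ∂unitMeasure))) : IsEnergyMin B₀ g₀ := by
  have hprim : ∀ t ∈ Icc (0 : ℝ) 1, Tendsto (fun n => prim (g n) t) atTop (𝓝 (prim g₀ t)) :=
    fun t ht => tendsto_prim_of_weak hgl ht
  have hmul : ∀ {B u : ℝ → ℝ}, IsHardness a b B → MemLp u 2 unitMeasure →
      MemLp (fun t => (B t)⁻¹ * u t) 2 unitMeasure := by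
    intro B u hB hu
    refine hu.of_le_mul (c := a⁻¹) ((hB.memLp_inv ha).1.mul hu.1) ?_
    filter_upwards [hB.mem] with t ht
    rw [norm_mul, norm_inv, Real.norm_eq_abs, abs_of_pos (ha.trans_le ht.1)]
    exact mul_le_mul_of_nonneg_right (inv_anti₀ ha ht.1) (norm_nonneg _)
  have hσ₀ := memLp_moment hg₀
  have hzero := ae_eq_zero_of_forall_integral_mul_eq_zero
    (hg₀.add (hmul hB₀ hσ₀)) (fun u hu => ?_)
  · refine hB₀.isEnergyMin_of_euler_lagrange ha hg₀ (fun t ht => ?_) ?_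
    · exact isClosed_Icc.mem_of_tendsto (hprim t ht)
        (Eventually.of_forall fun n => (hg n).prim_mem_Icc ha (hB n) ht)
    · filter_upwards [hzero, hB₀.mem] with t ht hm
      have h1 : g₀ t + (B₀ t)⁻¹ * moment g₀ t = 0 := ht
      have h2 : B₀ t ≠ 0 := (ha.trans_le hm.1).ne'
      field_simp at h1
      linarith
  · have hσu : MemLp (fun t => moment g₀ t * u t) 2 unitMeasure := by
      refine hu.of_le_mul (c := 2) (hσ₀.1.mul hu.1) ?_
      filter_upwards [ae_unit_mem] with t ht
      rw [norm_mul]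
      exact mul_le_mul_of_nonneg_right (abs_moment_le g₀ (Ioo_subset_Icc_self ht)) (norm_nonneg _)
    -- The product of compliance and moment is split: the compliance is tested against the fixed
    -- limit moment, and this error vanishes by dominated convergence since `|moment| ≤ 2`.
    have herr : Tendsto (fun n => ∫ t, (B n t)⁻¹ * ((moment (g n) t - moment g₀ t) * u t)
        ∂unitMeasure) atTop (𝓝 0) := by
      have hu1 : Integrable u unitMeasure := hu.integrable (by norm_num)
      rw [← integral_zero ℝ ℝ (μ := unitMeasure)]
      refine tendsto_integral_of_dominated_convergence (fun t => a⁻¹ * (4 * |u t|))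
        (fun n => ?_) ((hu1.abs.const_mul 4).const_mul _) (fun n => ?_) ?_
      · exact ((hB n).memLp_inv ha).1.mul (((memLp_moment (hg n).1).1.sub hσ₀.1).mul hu.1)
      · filter_upwards [(hB n).mem, ae_unit_mem] with t hm ht
        have ht' := Ioo_subset_Icc_self ht
        rw [norm_mul, norm_mul, norm_inv, Real.norm_eq_abs, abs_of_pos (ha.trans_le hm.1)]
        have h1 : |moment (g n) t - moment g₀ t| ≤ 4 :=
          (abs_sub _ _).trans (by linarith [abs_moment_le (g n) ht', abs_moment_le g₀ ht'])
        exact mul_le_mul (inv_anti₀ ha hm.1) (mul_le_mul_of_nonneg_right h1 (abs_nonneg _))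
          (by positivity) (inv_nonneg.2 ha.le)
      · have hall : ∀ᵐ t ∂unitMeasure, ∀ n, B n t ∈ Icc a b := ae_all_iff.2 fun n => (hB n).mem
        filter_upwards [hall, ae_unit_mem] with t hm ht
        have h1 := ((tendsto_moment (fun n => (hg n).1) hprim
          (Ioo_subset_Icc_self ht)).sub_const (moment g₀ t)).mul_const (u t)
        rw [sub_self, zero_mul] at h1
        have h2 : Tendsto (fun n => a⁻¹ * ‖(moment (g n) t - moment g₀ t) * u t‖) atTop (𝓝 0) := by
          simpa using h1.norm.const_mul a⁻¹
        refine squeeze_zero_norm (fun n => ?_) h2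
        rw [norm_mul, norm_inv, Real.norm_eq_abs, abs_of_pos (ha.trans_le (hm n).1)]
        exact mul_le_mul_of_nonneg_right (inv_anti₀ ha (hm n).1) (norm_nonneg _)
    have hlim := (hBl _ hσu).add herr
    have heq : ∀ n, ∫ t, (B n t)⁻¹ * (moment g₀ t * u t) ∂unitMeasure
        + ∫ t, (B n t)⁻¹ * ((moment (g n) t - moment g₀ t) * u t) ∂unitMeasure
        = -∫ t, g n t * u t ∂unitMeasure := by
      intro n
      have hi1 : Integrable (fun t => (B n t)⁻¹ * (moment g₀ t * u t)) unitMeasure :=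
        ((hB n).memLp_inv ha).integrable_mul hσu
      have hi2 : Integrable (fun t => (B n t)⁻¹ * ((moment (g n) t - moment g₀ t) * u t))
          unitMeasure := by
        have := (hmul (hB n) ((memLp_moment (hg n).1).sub hσ₀)).integrable_mul hu
        refine this.congr (Eventually.of_forall fun t => ?_)
        simp [mul_assoc]
      rw [← integral_add hi1 hi2, ← integral_neg]
      refine integral_congr_ae ?_
      filter_upwards [(hg n).euler_lagrange ha (hB n), (hB n).mem] with t ht hm
      have h2 : B n t ≠ 0 := (ha.trans_le hm.1).ne'
      have h3 : moment (g n) t = -(B n t * g n t) := by linarith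
      rw [h3]
      field_simp
      ring
    simp only [heq, add_zero] at hlim
    have huniq := tendsto_nhds_unique hlim (hgl u hu).neg
    have hi1 : Integrable (fun t => (B₀ t)⁻¹ * (moment g₀ t * u t)) unitMeasure :=
      (hB₀.memLp_inv ha).integrable_mul hσu
    have hi2 : Integrable (fun t => g₀ t * u t) unitMeasure := hg₀.integrable_mul hu
    have hsplit : ∫ t, (g₀ t + (B₀ t)⁻¹ * moment g₀ t) * u t ∂unitMeasure
        = ∫ t, g₀ t * u t ∂unitMeasure + ∫ t, (B₀ t)⁻¹ * (moment g₀ t * u t) ∂unitMeasure := by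
      rw [← integral_add hi2 hi1]
      congr 1; ext t; ring
    exact hsplit.trans (by rw [huniq, add_neg_cancel])

theorem IsHardness.integrable {a b : ℝ} {B : ℝ → ℝ} (ha : 0 < a) (hB : IsHardness a b B) :
    Integrable B unitMeasure := by
  refine Integrable.of_bound hB.aestronglyMeasurable b ?_
  filter_upwards [hB.mem] with t ht
  rw [Real.norm_eq_abs, abs_of_pos (ha.trans_le ht.1)]
  exact ht.2

/-- The mean hardness is lower semicontinuous under weak convergence of the compliances. -/
theorem IsHardness.integral_le_of_weak {a b : ℝ} (ha : 0 < a) {B : ℕ → ℝ → ℝ} {B₀ : ℝ → ℝ}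
    (hB : ∀ n, IsHardness a b (B n)) (hB₀ : IsHardness a b B₀)
    (hBl : ∀ u : ℝ → ℝ, MemLp u 2 unitMeasure →
      Tendsto (fun n => ∫ t, (B n t)⁻¹ * u t ∂unitMeasure) atTop
        (𝓝 (∫ t, (B₀ t)⁻¹ * u t ∂unitMeasure))) :
    ∃ l : ℕ → ℝ, Tendsto l atTop (𝓝 (∫ t, B₀ t ∂unitMeasure)) ∧
      ∀ n, l n ≤ ∫ t, B n t ∂unitMeasure := by
  have hsq : MemLp (fun t => B₀ t * B₀ t) 2 unitMeasure := by
    have h1 : MemLp B₀ 2 unitMeasure := by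
      simpa using hB₀.memLp_mul ha (memLp_const (1 : ℝ))
    exact hB₀.memLp_mul ha h1
  have hi : ∀ n, Integrable (fun t => (B n t)⁻¹ * (B₀ t * B₀ t)) unitMeasure :=
    fun n => ((hB n).memLp_inv ha).integrable_mul hsq
  -- Tangent inequality for `q ↦ 1 / q` at `1 / B₀`, namely `B ≥ 2 B₀ - B₀² / B`: the lower bound is
  -- affine in the compliance, so it converges.
  refine ⟨fun n => 2 * (∫ t, B₀ t ∂unitMeasure)
    - ∫ t, (B n t)⁻¹ * (B₀ t * B₀ t) ∂unitMeasure, ?_, fun n => ?_⟩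
  · have h1 := (hBl _ hsq).const_sub (2 * ∫ t, B₀ t ∂unitMeasure)
    have h2 : ∫ t, (B₀ t)⁻¹ * (B₀ t * B₀ t) ∂unitMeasure = ∫ t, B₀ t ∂unitMeasure := by
      refine integral_congr_ae ?_
      filter_upwards [hB₀.mem] with t ht
      have : B₀ t ≠ 0 := (ha.trans_le ht.1).ne'
      field_simp
    rwa [h2, two_mul, add_sub_cancel_right, ← two_mul] at h1
  · have hB₀i := hB₀.integrable ha
    beta_reduce
    rw [← integral_const_mul, ← integral_sub (hB₀i.const_mul 2) (hi n)]
    refine integral_mono_ae ((hB₀i.const_mul 2).sub (hi n)) ((hB n).integrable ha) ?_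
    filter_upwards [(hB n).mem] with t ht
    have hpos : 0 < B n t := ha.trans_le ht.1
    have h1 : B n t - (2 * B₀ t - (B n t)⁻¹ * (B₀ t * B₀ t))
        = (B n t)⁻¹ * (B n t - B₀ t) ^ 2 := by
      field_simp
      ring
    have h2 : 0 ≤ (B n t)⁻¹ * (B n t - B₀ t) ^ 2 := by positivity
    linarith

/-! ### Existence of an optimal design. -/

theorem integrable_design (θ : Lp ℝ ⊤ unitMeasure) : Integrable θ unitMeasure :=
  (Lp.memLp θ).integrable le_top

theorem integral_hardness (a b : ℝ) (θ : Lp ℝ ⊤ unitMeasure) :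
    ∫ t, hardness a b θ t ∂unitMeasure = a + (b - a) * ∫ t, θ t ∂unitMeasure := by
  have h : hardness a b θ = fun t => a + (b - a) * θ t := by
    ext t; simp only [hardness]; ring
  rw [h, integral_add (integrable_const a) ((integrable_design θ).const_mul _),
    integral_const_mul]
  simp

theorem IsHardness.exists_design {a b : ℝ} (hab : a < b) {B : ℝ → ℝ} (hB : IsHardness a b B) :
    ∃ θ ∈ designs, hardness a b θ =ᵐ[unitMeasure] B := by
  have hba : 0 < b - a := sub_pos.2 hab
  have hmem : ∀ᵐ t ∂unitMeasure, (B t - a) / (b - a) ∈ Icc (0 : ℝ) 1 := by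
    filter_upwards [hB.mem] with t ht
    exact ⟨div_nonneg (by linarith [ht.1]) hba.le, (div_le_one hba).2 (by linarith [ht.2])⟩
  have hLp : MemLp (fun t => (B t - a) / (b - a)) ⊤ unitMeasure := by
    refine memLp_top_of_bound ((hB.aestronglyMeasurable.sub
      aestronglyMeasurable_const).mul_const (b - a)⁻¹) 1 ?_
    filter_upwards [hmem] with t ht
    rw [Real.norm_eq_abs, abs_of_nonneg ht.1]
    exact ht.2
  refine ⟨hLp.toLp _, ?_, ?_⟩
  · change ∀ᵐ t ∂unitMeasure, hLp.toLp _ t ∈ Icc (0 : ℝ) 1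
    filter_upwards [hLp.coeFn_toLp, hmem] with t h1 h2
    rwa [h1]
  · filter_upwards [hLp.coeFn_toLp] with t h1
    rw [hardness, h1]
    field_simp
    ring

theorem isEnergyMin_congr_ae {B B' g : ℝ → ℝ} (h : B =ᵐ[unitMeasure] B') :
    IsEnergyMin B g ↔ IsEnergyMin B' g := by
  have : energy B = energy B' := by
    ext g
    rw [energy, energy]
    congr 2
    refine integral_congr_ae ?_
    filter_upwards [h] with t ht
    rw [ht]
  rw [IsEnergyMin, IsEnergyMin, this]

theorem exists_relaxedCost_min {a b c : ℝ} (ha : 0 < a) (hab : a < b) (hc : 0 < c) :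
    ∃ θ₀ ∈ designs, ∀ θ ∈ designs, relaxedCost a b c θ₀ ≤ relaxedCost a b c θ := by
  have hba : 0 < b - a := sub_pos.2 hab
  have hb : 0 < b := ha.trans hab
  set S : Set ℝ := relaxedCost a b c '' designs with hS
  have hne : S.Nonempty := by
    refine ⟨_, 0, ?_, rfl⟩
    change ∀ᵐ t ∂unitMeasure, (0 : Lp ℝ ⊤ unitMeasure) t ∈ Icc (0 : ℝ) 1
    filter_upwards [Lp.coeFn_zero ℝ ⊤ unitMeasure] with t ht
    rw [ht]
    simp
  have hbdd : BddBelow S := by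
    refine ⟨-1, ?_⟩
    rintro _ ⟨θ, hθ, rfl⟩
    obtain ⟨g, hg⟩ := (isHardness_hardness hab hθ).exists_isEnergyMin ha
    rw [relaxedCost_eq ha hab c hθ hg]
    have h1 := (abs_le.1 (abs_integral_load_le_one (K := prim g) Real.abs_sin_le_one)).2
    have hθ' : ∀ᵐ t ∂unitMeasure, θ t ∈ Icc (0 : ℝ) 1 := hθ
    have h2 : 0 ≤ ∫ t, θ t ∂unitMeasure :=
      integral_nonneg_of_ae (hθ'.mono fun t ht => ht.1)
    have := mul_nonneg hc.le h2
    linarith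
  obtain ⟨v, -, hv, hvS⟩ := exists_seq_tendsto_sInf hne hbdd
  choose θ hθ hθv using hvS
  have hH := fun n => isHardness_hardness hab (hθ n)
  choose g hg using fun n => (hH n).exists_isEnergyMin ha
  obtain ⟨q, hq, φ, hφ, hql⟩ := exists_weak_limit (C := (a⁻¹) ^ 2)
    (fun n => (hH n).memLp_inv ha) (fun n => by
      have hle : ∀ᵐ t ∂unitMeasure, (hardness a b (θ n) t)⁻¹ ^ 2 ≤ (a⁻¹) ^ 2 := by
        filter_upwards [(hH n).mem] with t ht
        have hpos : 0 < hardness a b (θ n) t := ha.trans_le ht.1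
        exact pow_le_pow_left₀ (by positivity) (inv_anti₀ ha ht.1) 2
      simpa using integral_mono_ae ((hH n).memLp_inv ha).integrable_sq
        (integrable_const ((a⁻¹) ^ 2)) hle)
  -- The competitor `0` has the same energy for every hardness, which bounds all the minimisers
  -- uniformly in `L²`.
  obtain ⟨g₀, hg₀, ψ, hψ, hgl⟩ := exists_weak_limit (C := 2 * (energy 0 0 + 1) / a)
    (fun n => (hg (φ n)).1) (fun n => by
      rw [le_div_iff₀' ha]
      refine ((hH (φ n)).integral_sq_le ha (hg (φ n)).1).trans ?_
      have h1 := (hg (φ n)).2 0 MemLp.zero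
      have h2 : energy (hardness a b (θ (φ n))) 0 = energy 0 0 := by simp [energy]
      linarith)
  have hql' : ∀ u : ℝ → ℝ, MemLp u 2 unitMeasure →
      Tendsto (fun n => ∫ t, (hardness a b (θ (φ (ψ n))) t)⁻¹ * u t ∂unitMeasure) atTop
        (𝓝 (∫ t, q t * u t ∂unitMeasure)) :=
    fun u hu => (hql u hu).comp hψ.tendsto_atTop
  have hq1 : ∀ᵐ t ∂unitMeasure, b⁻¹ ≤ q t :=
    ae_le_of_weak (fun _ => memLp_const b⁻¹) (fun n => (hH (φ (ψ n))).memLp_inv ha)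
      (memLp_const _) hq (fun _ _ => tendsto_const_nhds) hql' (fun n => by
        filter_upwards [(hH (φ (ψ n))).mem] with t ht
        exact inv_anti₀ (ha.trans_le ht.1) ht.2)
  have hq2 : ∀ᵐ t ∂unitMeasure, q t ≤ a⁻¹ :=
    ae_le_of_weak (fun n => (hH (φ (ψ n))).memLp_inv ha) (fun _ => memLp_const a⁻¹)
      hq (memLp_const _) hql' (fun _ _ => tendsto_const_nhds) (fun n => by
        filter_upwards [(hH (φ (ψ n))).mem] with t ht
        exact inv_anti₀ ha ht.1)
  have hB₀ : IsHardness a b (fun t => (q t)⁻¹) := by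
    refine ⟨hq.1.aemeasurable.inv.aestronglyMeasurable, ?_⟩
    filter_upwards [hq1, hq2] with t h1 h2
    have hpos : 0 < q t := (inv_pos.2 hb).trans_le h1
    exact ⟨(le_inv_comm₀ ha hpos).2 h2, (inv_le_comm₀ hpos hb).2 h1⟩
  have hmin : IsEnergyMin (fun t => (q t)⁻¹) g₀ :=
    IsHardness.isEnergyMin_of_weak ha (fun n => hH (φ (ψ n))) hB₀ (fun n => hg (φ (ψ n))) hg₀
      (by simpa using hql') hgl
  obtain ⟨l, hl, hle⟩ := IsHardness.integral_le_of_weak ha (fun n => hH (φ (ψ n))) hB₀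
    (by simpa using hql')
  obtain ⟨θ₀, hθ₀, hθ₀B⟩ := hB₀.exists_design hab
  have hmin₀ : IsEnergyMin (hardness a b θ₀) g₀ := (isEnergyMin_congr_ae hθ₀B).2 hmin
  have hload := tendsto_integral_load Real.continuous_sin Real.abs_sin_le_one
    (fun n => continuousOn_prim (hg (φ (ψ n))).1) (fun t ht => tendsto_prim_of_weak hgl ht)
  have hl₀ : ∫ t, (q t)⁻¹ ∂unitMeasure = a + (b - a) * ∫ t, θ₀ t ∂unitMeasure := by
    rw [← integral_hardness, integral_congr_ae hθ₀B]
  rw [hl₀] at hl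
  -- The volume is recovered from the mean hardness through `∫ θ = (∫ B - a) / (b - a)`; `l n`
  -- bounds that mean from below.
  have hlim := hload.neg.add (((hl.sub_const a).div_const (b - a)).const_mul c)
  rw [add_sub_cancel_left, mul_div_cancel_left₀ _ hba.ne', ← relaxedCost_eq ha hab c hθ₀ hmin₀]
    at hlim
  have hinf : relaxedCost a b c θ₀ ≤ sInf S := by
    refine le_of_tendsto_of_tendsto' hlim (hv.comp (hφ.comp hψ).tendsto_atTop) fun n => ?_
    rw [Function.comp_apply, Function.comp_apply, ← hθv,
      relaxedCost_eq ha hab c (hθ _) (hg _)]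
    have h1 := hle n
    rw [integral_hardness] at h1
    have h2 : (l n - a) / (b - a) ≤ ∫ t, θ (φ (ψ n)) t ∂unitMeasure := by
      rw [div_le_iff₀ hba]; linarith
    have h3 := mul_le_mul_of_nonneg_left h2 hc.le
    linarith
  exact ⟨θ₀, hθ₀, fun θ hθ => hinf.trans (csInf_le hbdd ⟨θ, hθ, rfl⟩)⟩

end PlateDesign

/-- The first conjunct says that the phase `K[B_θ]` is well defined: it is the unique global
minimiser of the energy, so that the functional `Ĵ` has its intended meaning. The second one says
that `Ĵ` attains its minimum. -/
theorem theorem5p1 (a b c : ℝ) (ha : 0 < a) (hab : a < b) (hc : 0 < c) :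
    (∀ θ ∈ PlateDesign.designs,
      PlateDesign.IsPhaseMinimiser (PlateDesign.hardness a b θ)
        (PlateDesign.phase (PlateDesign.hardness a b θ)) ∧
      ∀ K : ℝ → ℝ, PlateDesign.IsPhaseMinimiser (PlateDesign.hardness a b θ) K →
        Set.EqOn K (PlateDesign.phase (PlateDesign.hardness a b θ)) (Set.Icc 0 1)) ∧
    ∃ θ₀ ∈ PlateDesign.designs, ∀ θ ∈ PlateDesign.designs,
      PlateDesign.relaxedCost a b c θ₀ ≤ PlateDesign.relaxedCost a b c θ := by
  refine ⟨fun θ hθ => ?_, PlateDesign.exists_relaxedCost_min ha hab hc⟩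
  have hB := PlateDesign.isHardness_hardness hab hθ
  exact ⟨hB.isPhaseMinimiser_phase ha, fun K hK => hB.eqOn_phase ha hK⟩
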